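/- For an integer $s\ge 2$ let $\Omega^1(-1^s)$ be the set of rational 1-forms on the Riemann sphere $\widehat{\mathbb C}=\mathbb C\cup\{\infty\}$ that have exactly $s$ poles, all of them simple. Call $\omega\in\Omega^1(-1^s)$ isochronous if all its residues are purely imaginary, and let $\mathcal{RI}(-1^s)\subset\Omega^1(-1^s)$ be the set of isochronous forms. The group $PSL(2,\mathbb C)$ acts on rational 1-forms through Möbius transformations by $(T,\omega)\mapsto T_*\omega=(T^{-1})^*\omega$; the isotropy group of $\omega$ is $PSL(2,\mathbb C)_\omega=\{T\in PSL(2,\mathbb C) : T_*\omega=\omega\}$. **Proposition 3.3.** For every finite subgroup $G<PSL(2,\mathbb C)$ there are an integer $s\ge 2$ and an isochronous 1-form $\omega\in\mathcal{RI}(-1^s)$ such that $PSL(2,\mathbb C)_\omega=G$; in particular $PSL(2,\mathbb C)_\omega$ is isomorphic to $G$. -/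

import Mathlib

open scoped MatrixGroups

noncomputable section

/-- A rational 1-form on the Riemann sphere: `⟨f⟩` stands for `f(z) dz` with `f ∈ ℂ(z)`, where `z`
is the affine coordinate of `ℂ ∪ {∞}`. -/
@[ext] structure RationalOneForm where
  coeff : RatFunc ℂ

namespace RationalOneForm

/-! ### Substituting a Möbius transformation into a rational function -/

/-- The denominator `c z + d` of the Möbius transformation with matrix `(a, b; c, d)`. -/
def mobiusDenom (g : SL(2, ℂ)) : RatFunc ℂ :=
  RatFunc.C (g 1 0) * RatFunc.X + RatFunc.C (g 1 1)

/-- The Möbius transformation `(a z + b) / (c z + d)`, as a rational function of `z`. -/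
def mobius (g : SL(2, ℂ)) : RatFunc ℂ :=
  (RatFunc.C (g 0 0) * RatFunc.X + RatFunc.C (g 0 1)) / mobiusDenom g

lemma linear_eq_zero {a b : ℂ} (h : RatFunc.C a * RatFunc.X + RatFunc.C b = 0) :
    a = 0 ∧ b = 0 := by
  have h1 : algebraMap (Polynomial ℂ) (RatFunc ℂ)
      (Polynomial.C a * Polynomial.X + Polynomial.C b) = 0 := by
    simpa using h
  have h2 : Polynomial.C a * Polynomial.X + Polynomial.C b = 0 :=
    RatFunc.algebraMap_injective ℂ (by rw [h1, map_zero])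
  constructor
  · simpa using congrArg (fun p => Polynomial.coeff p 1) h2
  · simpa using congrArg (fun p => Polynomial.coeff p 0) h2

lemma det_eq (g : SL(2, ℂ)) : g 0 0 * g 1 1 - g 0 1 * g 1 0 = 1 := by
  have := g.det_coe
  rwa [Matrix.det_fin_two] at this

lemma mobiusDenom_ne_zero (g : SL(2, ℂ)) : mobiusDenom g ≠ 0 := by
  intro h
  obtain ⟨h0, h1⟩ := linear_eq_zero h
  have := det_eq g
  simp [h0, h1] at this

lemma transcendental_mobius (g : SL(2, ℂ)) : Transcendental ℂ (mobius g) := by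
  intro halg
  have hint : IsIntegral ℂ (mobius g) := halg.isIntegral
  obtain ⟨c, hc⟩ := minpoly.mem_range_of_degree_eq_one ℂ (mobius g)
    (IsAlgClosed.degree_eq_one_of_irreducible ℂ (minpoly.irreducible hint))
  rw [RatFunc.algebraMap_eq_C, mobius, eq_div_iff (mobiusDenom_ne_zero g), mobiusDenom] at hc
  have h : RatFunc.C (g 0 0 - c * g 1 0) * RatFunc.X + RatFunc.C (g 0 1 - c * g 1 1) = 0 := by
    simp only [map_sub, map_mul]
    linear_combination -hc
  obtain ⟨h0, h1⟩ := linear_eq_zero h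
  have := det_eq g
  have hz : g 0 0 * g 1 1 - g 0 1 * g 1 0 = 0 := by
    linear_combination g 1 1 * h0 - g 1 0 * h1
  rw [hz] at this
  exact zero_ne_one this

/-- The substitution `f(z) ↦ f((a z + b) / (c z + d))` on `ℂ(z)`. -/
def subst (g : SL(2, ℂ)) : RatFunc ℂ →ₐ[ℂ] RatFunc ℂ :=
  RatFunc.liftAlgHom (Polynomial.aeval (mobius g))
    (nonZeroDivisors_le_comap_nonZeroDivisors_of_injective _
      (transcendental_iff_injective.mp (transcendental_mobius g)))

lemma subst_X (g : SL(2, ℂ)) : subst g RatFunc.X = mobius g := by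
  have := RatFunc.liftAlgHom_apply_div (Polynomial.aeval (mobius g))
    (nonZeroDivisors_le_comap_nonZeroDivisors_of_injective _
      (transcendental_iff_injective.mp (transcendental_mobius g))) Polynomial.X 1
  simpa [subst] using this

lemma subst_C (g : SL(2, ℂ)) (c : ℂ) : subst g (RatFunc.C c) = RatFunc.C c := by
  rw [← RatFunc.algebraMap_eq_C]
  exact (subst g).commutes c

lemma algHom_ext {φ ψ : RatFunc ℂ →ₐ[ℂ] RatFunc ℂ} (h : φ RatFunc.X = ψ RatFunc.X) : φ = ψ := by
  have hp : φ.comp (IsScalarTower.toAlgHom ℂ (Polynomial ℂ) (RatFunc ℂ)) =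
      ψ.comp (IsScalarTower.toAlgHom ℂ (Polynomial ℂ) (RatFunc ℂ)) := by
    apply Polynomial.algHom_ext
    simpa using h
  ext f
  have hq : ∀ p : Polynomial ℂ, φ (algebraMap _ _ p) = ψ (algebraMap _ _ p) :=
    fun p => DFunLike.congr_fun hp p
  rw [← RatFunc.num_div_denom f, map_div₀, map_div₀, hq, hq]

lemma subst_mobiusDenom (g h : SL(2, ℂ)) :
    subst h (mobiusDenom g) * mobiusDenom h = mobiusDenom (g * h) := by
  have hh := mobiusDenom_ne_zero h
  have e : mobius h * mobiusDenom h =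
      RatFunc.C (h 0 0) * RatFunc.X + RatFunc.C (h 0 1) := div_mul_cancel₀ _ hh
  have e2 : mobiusDenom h = RatFunc.C (h 1 0) * RatFunc.X + RatFunc.C (h 1 1) := rfl
  have e3 : mobiusDenom (g * h) = RatFunc.C ((g * h) 1 0) * RatFunc.X + RatFunc.C ((g * h) 1 1) :=
    rfl
  have e4 : subst h (mobiusDenom g) = RatFunc.C (g 1 0) * mobius h + RatFunc.C (g 1 1) := by
    simp [mobiusDenom, subst_X, subst_C]
  rw [e4, e3]
  simp only [Matrix.SpecialLinearGroup.coe_mul, Matrix.mul_apply, Fin.sum_univ_two, map_add,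
    map_mul]
  linear_combination RatFunc.C (g 1 0) * e + RatFunc.C (g 1 1) * e2

lemma subst_mobius (g h : SL(2, ℂ)) : subst h (mobius g) = mobius (g * h) := by
  have hh := mobiusDenom_ne_zero h
  have e : mobius h * mobiusDenom h =
      RatFunc.C (h 0 0) * RatFunc.X + RatFunc.C (h 0 1) := div_mul_cancel₀ _ hh
  have e2 : mobiusDenom h = RatFunc.C (h 1 0) * RatFunc.X + RatFunc.C (h 1 1) := rfl
  have e4 : subst h (mobius g) =
      (RatFunc.C (g 0 0) * mobius h + RatFunc.C (g 0 1)) / subst h (mobiusDenom g) := by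
    rw [mobius, map_div₀]
    simp [subst_X, subst_C]
  have e5 : mobius (g * h) =
      (RatFunc.C ((g * h) 0 0) * RatFunc.X + RatFunc.C ((g * h) 0 1)) / mobiusDenom (g * h) := rfl
  rw [e4, ← mul_div_mul_right _ _ hh, subst_mobiusDenom, e5]
  congr 1
  simp only [Matrix.SpecialLinearGroup.coe_mul, Matrix.mul_apply, Fin.sum_univ_two, map_add,
    map_mul]
  linear_combination RatFunc.C (g 0 0) * e + RatFunc.C (g 0 1) * e2

lemma subst_subst (g h : SL(2, ℂ)) (f : RatFunc ℂ) : subst h (subst g f) = subst (g * h) f := by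
  have : (subst h).comp (subst g) = subst (g * h) := by
    apply algHom_ext
    simp [subst_X, subst_mobius]
  exact DFunLike.congr_fun this f

/-! ### The action of `PSL(2, ℂ)` on rational 1-forms -/

/-- The pullback `g^* ω` of `ω = f(z) dz` under `g(z) = (a z + b) / (c z + d)`, `a d - b c = 1`:
since `g'(z) = 1 / (c z + d)^2`, it is `f(g(z)) / (c z + d)^2 dz`. -/
def pullback (g : SL(2, ℂ)) (ω : RationalOneForm) : RationalOneForm :=
  ⟨subst g ω.coeff / mobiusDenom g ^ 2⟩

lemma pullback_pullback (g h : SL(2, ℂ)) (ω : RationalOneForm) :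
    pullback h (pullback g ω) = pullback (g * h) ω := by
  ext
  simp only [pullback, map_div₀, map_pow, subst_subst, ← subst_mobiusDenom g h, mul_pow,
    div_div]

lemma pullback_scalar (g : SL(2, ℂ)) (hg : g ∈ Subgroup.center SL(2, ℂ)) (ω : RationalOneForm) :
    pullback g ω = ω := by
  obtain ⟨r, hr, hs⟩ := Matrix.SpecialLinearGroup.mem_center_iff.mp hg
  simp only [Fintype.card_fin] at hr
  have h00 : g 0 0 = r := by rw [← hs]; simp
  have h01 : g 0 1 = 0 := by rw [← hs]; simp
  have h10 : g 1 0 = 0 := by rw [← hs]; simp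
  have h11 : g 1 1 = r := by rw [← hs]; simp
  have hr0 : r ≠ 0 := by rintro rfl; simp at hr
  have hC : RatFunc.C r ≠ 0 := by simpa using hr0
  have hd : mobiusDenom g = RatFunc.C r := by simp [mobiusDenom, h10, h11]
  have hm : mobius g = RatFunc.X := by
    rw [mobius, hd, h00, h01, map_zero, add_zero, mul_div_cancel_left₀ _ hC]
  have hsub : subst g = AlgHom.id ℂ (RatFunc ℂ) := by
    apply algHom_ext
    simp [subst_X, hm]
  ext
  simp [pullback, hd, hsub, ← map_pow, hr]

/-- `SL(2, ℂ)` acts on rational 1-forms by `g_* ω = (g⁻¹)^* ω`. -/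
instance : MulAction SL(2, ℂ) RationalOneForm where
  smul g ω := pullback g⁻¹ ω
  one_smul ω := by
    change pullback 1⁻¹ ω = ω
    rw [inv_one]
    exact pullback_scalar 1 (Subgroup.one_mem _) ω
  mul_smul g h ω := by
    change pullback (g * h)⁻¹ ω = pullback g⁻¹ (pullback h⁻¹ ω)
    rw [pullback_pullback, mul_inv_rev]

lemma smul_def (g : SL(2, ℂ)) (ω : RationalOneForm) : g • ω = pullback g⁻¹ ω := rfl

/-- The homomorphism `PSL(2, ℂ) → Perm` underlying the action `T ↦ T_*` on rational 1-forms. -/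
def pslToPerm : PSL(2, ℂ) →* Equiv.Perm RationalOneForm :=
  QuotientGroup.lift _ (MulAction.toPermHom SL(2, ℂ) RationalOneForm) (by
    intro g hg
    rw [MonoidHom.mem_ker]
    ext1 ω
    exact pullback_scalar g⁻¹ (Subgroup.inv_mem _ hg) ω)

/-- `PSL(2, ℂ)` acts on rational 1-forms by `(T, ω) ↦ T_* ω`. -/
instance : MulAction PSL(2, ℂ) RationalOneForm :=
  MulAction.compHom _ pslToPerm

lemma mk_smul (g : SL(2, ℂ)) (ω : RationalOneForm) :
    (QuotientGroup.mk g : PSL(2, ℂ)) • ω = pullback g⁻¹ ω := rfl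

/-- The isotropy group `{T ∈ PSL(2, ℂ) | T_* ω = ω}`. -/
def isotropyGroup (ω : RationalOneForm) : Subgroup PSL(2, ℂ) :=
  MulAction.stabilizer PSL(2, ℂ) ω

/-! ### Poles and residues -/

/-- The Möbius transformation `w ↦ -1 / w`; its restriction to a neighbourhood of `w = 0` is a
local parametrization of the sphere at `∞`. -/
def inversion : SL(2, ℂ) := ⟨!![0, -1; 1, 0], by simp⟩

/-- The expression `F(t)` of a rational 1-form `ω = F(t) dt` near a point of the sphere, in the local
coordinate `t = z - a` at `a ∈ ℂ`, and `t = -1 / z` at `∞`. -/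
def localCoeff (ω : RationalOneForm) : OnePoint ℂ → RatFunc ℂ
  | some a => RatFunc.laurent a ω.coeff
  | none => (pullback inversion ω).coeff

/-- The order at `t = 0` of a rational function of `t`, read off its Laurent series at `0`
(it is `0` for the zero function). -/
def orderAtZero {F : Type*} [Field F] (f : RatFunc F) : ℤ :=
  (f : LaurentSeries F).order

/-- The coefficient of `t⁻¹` in the Laurent series at `0` of a rational function of `t`. -/
def residueAtZero {F : Type*} [Field F] (f : RatFunc F) : F :=
  (f : LaurentSeries F).coeff (-1)

/-- The order of a rational 1-form at a point of the Riemann sphere (negative at poles). -/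
def orderAt (ω : RationalOneForm) (p : OnePoint ℂ) : ℤ :=
  orderAtZero (localCoeff ω p)

/-- The residue of a rational 1-form at a point of the Riemann sphere. -/
def residue (ω : RationalOneForm) (p : OnePoint ℂ) : ℂ :=
  residueAtZero (localCoeff ω p)

/-- The set of poles of a rational 1-form on the Riemann sphere. -/
def poles (ω : RationalOneForm) : Set (OnePoint ℂ) :=
  {p | orderAt ω p < 0}

/-- `Ω¹(-1ˢ)`: rational 1-forms with exactly `s` poles, all of them simple. -/
def simplePoleForms (s : ℕ) : Set RationalOneForm :=
  {ω | (poles ω).encard = s ∧ ∀ p ∈ poles ω, orderAt ω p = -1}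

/-- `ω` is isochronous: all its residues (at its poles) are purely imaginary. -/
def IsIsochronous (ω : RationalOneForm) : Prop :=
  ∀ p ∈ poles ω, (residue ω p).re = 0

end RationalOneForm

end

/-!
A rational 1-form with only simple poles is determined by its residues, and any finitely supported
`r : ℂ ∪ {∞} → ℂ` with sum zero is the residue function of such a form, namely of
`∑ r_p dz / (z - p)` (`ofResidues`). Möbius transformations act on these forms by moving the
residues (`smul_ofResidues`), so the isotropy group of the form consists of the `T ∈ PSL(2, ℂ)`
with `r ∘ T = r` (`mem_isotropyGroup_ofResidues`).

Hence it suffices to find a purely imaginary `r` of sum zero with symmetry group exactly `G`. This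
needs no classification of the finite subgroups. Let `B` be a finite `G`-invariant set with at least
three points. Since a nontrivial Möbius transformation fixes at most two points, only finitely many
`T` preserve `B`, and for a point `t` outside a finite set, `T t = k t` with `T` preserving `B` and
`k ∈ G` forces `T = k`. With `A` the `G`-orbit of such a `t`, the group `G` is the group of all
transformations preserving both `A` and `B` (`exists_finset_pair_stabilizer`). The residues `i |B|`
on `A` and `-i |A|` on `B` have sum zero, and the sign of their imaginary part tells `A` from `B`.
-/

open scoped MatrixGroups

noncomputable section

/-! ### The action of `PSL(2, ℂ)` on the Riemann sphere -/

namespace MobiusAction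

open OnePoint

/-- `SL(2, ℂ)` acts on the Riemann sphere by Möbius transformations. -/
instance instMulActionSL : MulAction SL(2, ℂ) (OnePoint ℂ) :=
  MulAction.compHom _ (Matrix.SpecialLinearGroup.toGL (n := Fin 2) (R := ℂ))

lemma sl_smul_coe (g : SL(2, ℂ)) (z : ℂ) :
    g • (z : OnePoint ℂ) = if g 1 0 * z + g 1 1 = 0 then ∞ else
      (((g 0 0 * z + g 0 1) / (g 1 0 * z + g 1 1) : ℂ) : OnePoint ℂ) :=
  OnePoint.smul_some_eq_ite (g := Matrix.SpecialLinearGroup.toGL g)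

lemma sl_smul_infty (g : SL(2, ℂ)) :
    g • (∞ : OnePoint ℂ) = if g 1 0 = 0 then ∞ else ((g 0 0 / g 1 0 : ℂ) : OnePoint ℂ) :=
  OnePoint.smul_infty_eq_ite (Matrix.SpecialLinearGroup.toGL g)

lemma sl_smul_of_mem_center {g : SL(2, ℂ)} (hg : g ∈ Subgroup.center SL(2, ℂ))
    (p : OnePoint ℂ) : g • p = p := by
  obtain ⟨r, hr, hs⟩ := Matrix.SpecialLinearGroup.mem_center_iff.mp hg
  have hr0 : r ≠ 0 := by rintro rfl; simp at hr
  have h00 : g 0 0 = r := by rw [← hs]; simp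
  have h01 : g 0 1 = 0 := by rw [← hs]; simp
  have h10 : g 1 0 = 0 := by rw [← hs]; simp
  have h11 : g 1 1 = r := by rw [← hs]; simp
  cases p with
  | infty => simp [sl_smul_infty, h10]
  | coe z => simp [sl_smul_coe, h00, h01, h10, h11, hr0]

/-- The permutation of the sphere underlying an element of `PSL(2, ℂ)`. -/
def pslToPermSphere : PSL(2, ℂ) →* Equiv.Perm (OnePoint ℂ) :=
  QuotientGroup.lift _ (MulAction.toPermHom SL(2, ℂ) (OnePoint ℂ)) (by
    intro g hg
    rw [MonoidHom.mem_ker]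
    ext1 p
    exact sl_smul_of_mem_center hg p)

/-- `PSL(2, ℂ)` acts on the Riemann sphere by Möbius transformations. -/
instance instMulActionPSL : MulAction PSL(2, ℂ) (OnePoint ℂ) :=
  MulAction.compHom _ pslToPermSphere

lemma mk_smul_point (g : SL(2, ℂ)) (p : OnePoint ℂ) :
    (QuotientGroup.mk g : PSL(2, ℂ)) • p = g • p := rfl

lemma mem_center_of_offDiag_eq_zero {g : SL(2, ℂ)} (h01 : g 0 1 = 0) (h10 : g 1 0 = 0)
    (hd : g 0 0 = g 1 1) : g ∈ Subgroup.center SL(2, ℂ) := by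
  rw [Matrix.SpecialLinearGroup.mem_center_iff]
  refine ⟨g 0 0, ?_, ?_⟩
  · have := RationalOneForm.det_eq g
    simp only [Fintype.card_fin]
    linear_combination this + g 0 0 * hd + g 1 0 * h01
  · ext i j
    fin_cases i <;> fin_cases j <;> simp [h01, h10, hd]

/-- The finite fixed points are roots of a quadratic polynomial, whose leading coefficient
vanishes exactly when `∞` is fixed as well. -/
lemma sl_encard_fixed_le_two {g : SL(2, ℂ)} (hg : g ∉ Subgroup.center SL(2, ℂ)) :
    {p : OnePoint ℂ | g • p = p}.encard ≤ 2 := by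
  have hdet := RationalOneForm.det_eq g
  have hcoe : ∀ z : ℂ, g • (z : OnePoint ℂ) = z →
      g 1 0 * z ^ 2 + (g 1 1 - g 0 0) * z - g 0 1 = 0 := by
    intro z hz
    rw [sl_smul_coe] at hz
    split_ifs at hz with h
    · exact absurd hz (OnePoint.infty_ne_coe z)
    · rw [OnePoint.coe_eq_coe, div_eq_iff h] at hz
      linear_combination -hz
  have hinf : g • (∞ : OnePoint ℂ) = ∞ → g 1 0 = 0 := by
    intro hi
    rw [sl_smul_infty] at hi
    by_contra h
    rw [if_neg h] at hi
    exact OnePoint.coe_ne_infty _ hi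
  have hpair : ∀ a b : OnePoint ℂ, ({a, b} : Set (OnePoint ℂ)).encard ≤ 2 := fun a b =>
    (Set.encard_insert_le _ _).trans (by rw [Set.encard_singleton]; norm_num)
  by_cases hc : g 1 0 = 0
  · by_cases ha : g 1 1 - g 0 0 = 0
    · -- The matrix is, up to sign, a translation: only `∞` is fixed.
      refine (Set.encard_le_encard ?_).trans (hpair ∞ ∞)
      intro p hp
      cases p with
      | infty => simp
      | coe z =>
        exfalso
        have h01 := hcoe z hp
        rw [hc, ha] at h01
        exact hg (mem_center_of_offDiag_eq_zero (by linear_combination -h01) hc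
          (by linear_combination -ha))
    · refine (Set.encard_le_encard ?_).trans
        (hpair ∞ ((g 0 1 / (g 1 1 - g 0 0) : ℂ) : OnePoint ℂ))
      intro p hp
      cases p with
      | infty => simp
      | coe z =>
        have h01 := hcoe z hp
        right
        rw [Set.mem_singleton_iff, OnePoint.coe_eq_coe, eq_div_iff ha]
        rw [hc] at h01
        linear_combination h01
  · obtain ⟨w, hw⟩ := IsAlgClosed.exists_pow_nat_eq
      ((g 1 1 - g 0 0) ^ 2 + 4 * g 1 0 * g 0 1) (n := 2) (by norm_num)
    refine (Set.encard_le_encard ?_).trans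
      (hpair (((g 0 0 - g 1 1 + w) / (2 * g 1 0) : ℂ) : OnePoint ℂ)
        (((g 0 0 - g 1 1 - w) / (2 * g 1 0) : ℂ) : OnePoint ℂ))
    intro p hp
    cases p with
    | infty => exact absurd (hinf hp) hc
    | coe z =>
      have hz := hcoe z hp
      have h2 : (2 * g 1 0 : ℂ) ≠ 0 := mul_ne_zero two_ne_zero hc
      have hprod : (z * (2 * g 1 0) - (g 0 0 - g 1 1 + w)) *
          (z * (2 * g 1 0) - (g 0 0 - g 1 1 - w)) = 0 := by
        linear_combination 4 * g 1 0 * hz - hw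
      rcases mul_eq_zero.mp hprod with h | h
      · left
        rw [OnePoint.coe_eq_coe, eq_div_iff h2]
        exact sub_eq_zero.mp h
      · right
        rw [Set.mem_singleton_iff, OnePoint.coe_eq_coe, eq_div_iff h2]
        exact sub_eq_zero.mp h

lemma psl_encard_fixed_le_two {T : PSL(2, ℂ)} (hT : T ≠ 1) :
    {p : OnePoint ℂ | T • p = p}.encard ≤ 2 := by
  induction T using QuotientGroup.induction_on with
  | H g => exact sl_encard_fixed_le_two fun hg => hT ((QuotientGroup.eq_one_iff g).mpr hg)

end MobiusAction

/-! ### Finite subgroups as stabilizers of pairs of finite sets -/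

/-- In an action on an infinite set for which a nontrivial element fixes at most two points, a
finite subgroup is the group of all elements preserving two suitable disjoint finite sets. One of
them, `B`, is invariant and has three points, so that only finitely many elements preserve it. The
other is the orbit of a point at which no two of these elements agree, except if they are equal. -/
lemma exists_finset_pair_stabilizer {Γ X : Type*} [Group Γ] [MulAction Γ X] [Infinite X]
    (hfix : ∀ T : Γ, T ≠ 1 → {x : X | T • x = x}.encard ≤ 2) (G : Subgroup Γ) (hG : Finite G) :
    ∃ A B : Finset X, A.Nonempty ∧ B.Nonempty ∧ Disjoint A B ∧
      ∀ T : Γ, T ∈ G ↔ (∀ x, T • x ∈ A ↔ x ∈ A) ∧ ∀ x, T • x ∈ B ↔ x ∈ B := by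
  classical
  have eq_of_smul : ∀ T U : Γ, ∀ x : X, U⁻¹ • T • x = x ↔ T • x = U • x := fun T U x =>
    inv_smul_eq_iff
  obtain ⟨S, hS⟩ := Infinite.exists_subset_card_eq X 3
  let orbit : X → Set X := fun x => Set.range fun k : G => (k : Γ) • x
  have horbit : ∀ (T : Γ), T ∈ G → ∀ x y, T • y ∈ orbit x ↔ y ∈ orbit x := by
    intro T hT x y
    constructor
    · rintro ⟨k, hk⟩
      refine ⟨⟨T⁻¹ * k, G.mul_mem (G.inv_mem hT) k.2⟩, ?_⟩
      simp only [mul_smul] at hk ⊢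
      rw [hk, inv_smul_smul]
    · rintro ⟨k, rfl⟩
      exact ⟨⟨T * k, G.mul_mem hT k.2⟩, mul_smul _ _ _⟩
  have hself : ∀ x, x ∈ orbit x := fun x => ⟨1, one_smul _ _⟩
  have hofin : ∀ x, (orbit x).Finite := fun x => Set.finite_range _
  have hBfin : (⋃ x ∈ S, orbit x).Finite := S.finite_toSet.biUnion fun x _ => hofin x
  set B := hBfin.toFinset with hB
  have hmemB : ∀ y, y ∈ B ↔ ∃ x ∈ S, y ∈ orbit x := by simp [hB]
  have hSB : S ⊆ B := fun x hx => (hmemB x).mpr ⟨x, hx, hself x⟩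
  have hGB : ∀ T ∈ G, ∀ x, T • x ∈ B ↔ x ∈ B := by
    intro T hT x
    simp only [hmemB, horbit T hT]
  let F : Set Γ := {T | ∀ x, T • x ∈ B ↔ x ∈ B}
  have hF : F.Finite := by
    let φ : F → (B → B) := fun T x => ⟨(T : Γ) • (x : X), (T.2 x).mpr x.2⟩
    have hφ : Function.Injective φ := by
      intro T U hTU
      by_contra hne
      have h1 : (U : Γ)⁻¹ * T ≠ 1 := fun h => hne (Subtype.ext (inv_mul_eq_one.mp h).symm)
      have hsub : (S : Set X) ⊆ {x : X | ((U : Γ)⁻¹ * (T : Γ)) • x = x} := by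
        intro x hx
        have := congrArg Subtype.val (congrFun hTU ⟨x, hSB hx⟩)
        rw [Set.mem_ofPred_eq, mul_smul, eq_of_smul]
        exact this
      have := (Set.encard_le_encard hsub).trans (hfix _ h1)
      rw [Set.encard_coe_eq_coe_finsetCard, hS] at this
      exact absurd this (by decide)
    exact Set.finite_coe_iff.mp (Finite.of_injective φ hφ)
  have hbad : ((B : Set X) ∪ ⋃ T ∈ F, ⋃ k ∈ (G : Set Γ), {x | T ≠ k ∧ T • x = k • x}).Finite := by
    refine B.finite_toSet.union (hF.biUnion fun T _ => Set.Finite.biUnion hG fun k _ => ?_)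
    by_cases h : T = k
    · simp [h]
    · have h1 : k⁻¹ * T ≠ 1 := fun h' => h (inv_mul_eq_one.mp h').symm
      refine (Set.finite_of_encard_le_coe (k := 2) (hfix _ h1)).subset ?_
      rintro x ⟨-, hx⟩
      rw [Set.mem_ofPred_eq, mul_smul, eq_of_smul]
      exact hx
  obtain ⟨t, ht⟩ := hbad.exists_notMem
  simp only [Set.mem_union, Set.mem_iUnion, Set.mem_ofPred_eq, not_or, not_exists] at ht
  refine ⟨(hofin t).toFinset, B, ⟨t, by simpa using hself t⟩, ?_, ?_, ?_⟩
  · exact (Finset.card_pos.mp (by rw [hS]; norm_num)).mono hSB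
  · rw [Finset.disjoint_left]
    intro x hx hxB
    obtain ⟨k, rfl⟩ := (hofin t).mem_toFinset.mp hx
    exact ht.1 ((hGB k k.2 t).mp hxB)
  · intro T
    simp only [Set.Finite.mem_toFinset]
    refine ⟨fun hT => ⟨horbit T hT t, hGB T hT⟩, ?_⟩
    rintro ⟨hTA, hTB⟩
    obtain ⟨k, hk⟩ := (hTA t).mpr (hself t)
    have : T = k := by
      by_contra hne
      exact ht.2 T hTB k k.2 ⟨hne, hk.symm⟩
    rw [this]
    exact k.2

/-! ### Forms with prescribed residues -/

namespace RationalOneForm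

open MobiusAction
open scoped OnePoint

/-- The coefficient `1 / (z - p)` of the elementary form with a simple pole of residue `1` at `p`,
and another simple pole at `∞` if `p ≠ ∞`. For `p = ∞` it is `0`, which is the right value for
the pole at `∞` to be determined by the other ones through the residue theorem. -/
def cauchyKernel : OnePoint ℂ → RatFunc ℂ
  | OnePoint.some a => (RatFunc.X - RatFunc.C a)⁻¹
  | ∞ => 0

lemma cauchyKernel_infty : cauchyKernel ∞ = 0 := rfl

lemma cauchyKernel_coe (a : ℂ) : cauchyKernel a = (RatFunc.X - RatFunc.C a)⁻¹ := rfl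

/-- The form `∑ r_p dz / (z - p)`. If `r` has degree zero, it has residue `r_p` at each `p`,
including `p = ∞`. -/
def ofResidues (r : OnePoint ℂ →₀ ℂ) : RationalOneForm :=
  ⟨Finsupp.linearCombination ℂ cauchyKernel r⟩

/-- The kernel at a point with homogeneous coordinates `[u : v]`. -/
lemma cauchyKernel_ite (u v : ℂ) :
    cauchyKernel (if v = 0 then ∞ else ((u / v : ℂ) : OnePoint ℂ)) =
      RatFunc.C v / (RatFunc.C v * RatFunc.X - RatFunc.C u) := by
  split_ifs with h
  · simp [h, cauchyKernel_infty]
  · have hv : RatFunc.C v ≠ 0 := by simpa using h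
    rw [cauchyKernel_coe, map_div₀, inv_eq_one_div, ← mul_div_mul_left _ _ hv, mul_one, mul_sub,
      mul_div_cancel₀ _ hv]

lemma inv_entries (g : SL(2, ℂ)) :
    g⁻¹ 0 0 = g 1 1 ∧ g⁻¹ 0 1 = -g 0 1 ∧ g⁻¹ 1 0 = -g 1 0 ∧ g⁻¹ 1 1 = g 0 0 := by
  simp [Matrix.SpecialLinearGroup.SL2_inv_expl]

/-- Pulling back `dz / (z - p)`, which has simple poles at `p` and `∞` with residues `1` and `-1`,
yields the form with these residues at the preimages of `p` and `∞`. -/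
lemma pullback_cauchyKernel (g : SL(2, ℂ)) (p : OnePoint ℂ) :
    subst g (cauchyKernel p) / mobiusDenom g ^ 2 =
      cauchyKernel (g⁻¹ • p) - cauchyKernel (g⁻¹ • ∞) := by
  cases p with
  | infty => simp [cauchyKernel_infty]
  | coe a =>
    have hdet := det_eq g
    have hD := mobiusDenom_ne_zero g
    obtain ⟨i00, i01, i10, i11⟩ := inv_entries g
    have hN : RatFunc.C (g 0 0 - a * g 1 0) * RatFunc.X + RatFunc.C (g 0 1 - a * g 1 1) ≠ 0 := by
      intro h
      obtain ⟨h0, h1⟩ := linear_eq_zero h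
      exact one_ne_zero (α := ℂ)
        (by linear_combination -hdet + g 1 1 * h0 - g 1 0 * h1)
    have hsub : subst g (cauchyKernel a) = mobiusDenom g /
        (RatFunc.C (g 0 0 - a * g 1 0) * RatFunc.X + RatFunc.C (g 0 1 - a * g 1 1)) := by
      rw [cauchyKernel_coe, map_inv₀, map_sub, subst_X, subst_C, mobius, div_sub' hD, inv_div]
      congr 1
      simp only [mobiusDenom, map_sub, map_mul]
      ring
    have hC : (RatFunc.C (g 0 0) * RatFunc.C (g 1 1) - RatFunc.C (g 0 1) * RatFunc.C (g 1 0) :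
        RatFunc ℂ) = 1 := by
      rw [← map_mul, ← map_mul, ← map_sub, hdet, map_one]
    have e1 : cauchyKernel (g⁻¹ • (a : OnePoint ℂ)) = RatFunc.C (g 0 0 - a * g 1 0) /
        (RatFunc.C (g 0 0 - a * g 1 0) * RatFunc.X + RatFunc.C (g 0 1 - a * g 1 1)) := by
      rw [sl_smul_coe, cauchyKernel_ite, i00, i01, i10, i11]
      simp only [map_sub, map_add, map_mul, map_neg]
      congr 1 <;> ring
    have e2 : cauchyKernel (g⁻¹ • ∞) = RatFunc.C (g 1 0) / mobiusDenom g := by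
      rw [sl_smul_infty, cauchyKernel_ite, i00, i10, ← neg_div_neg_eq]
      simp only [mobiusDenom, map_neg]
      congr 1 <;> ring
    rw [hsub, e1, e2, div_sub_div _ _ hN hD, div_div, div_eq_div_iff
      (mul_ne_zero hN (pow_ne_zero 2 hD)) (mul_ne_zero hN hD)]
    have hDe : mobiusDenom g = RatFunc.C (g 1 0) * RatFunc.X + RatFunc.C (g 1 1) := rfl
    have key : RatFunc.C (g 0 0 - a * g 1 0) * mobiusDenom g -
        (RatFunc.C (g 0 0 - a * g 1 0) * RatFunc.X + RatFunc.C (g 0 1 - a * g 1 1)) *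
          RatFunc.C (g 1 0) = 1 := by
      rw [hDe]
      simp only [map_sub, map_mul]
      linear_combination hC
    rw [key]
    ring

lemma pullback_ofResidues (g : SL(2, ℂ)) {r : OnePoint ℂ →₀ ℂ} (hr : r.degree = 0) :
    pullback g (ofResidues r) = ofResidues (r.mapDomain (g⁻¹ • ·)) := by
  have h : ∀ r : OnePoint ℂ →₀ ℂ,
      subst g (Finsupp.linearCombination ℂ cauchyKernel r) / mobiusDenom g ^ 2 =
        Finsupp.linearCombination ℂ cauchyKernel (r.mapDomain (g⁻¹ • ·)) -
          r.degree • cauchyKernel (g⁻¹ • ∞) := by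
    intro r
    induction r using Finsupp.induction_linear with
    | zero => simp
    | add r s hr hs =>
      simp only [map_add, add_div, hr, hs, Finsupp.mapDomain_add, add_smul]
      abel
    | single p c =>
      simp only [Finsupp.linearCombination_single, Finsupp.mapDomain_single,
        Finsupp.degree_single, RatFunc.smul_eq_C_mul, map_mul, subst_C, mul_div_assoc,
        pullback_cauchyKernel, mul_sub]
  ext
  simp [pullback, ofResidues, h, hr]

/-- Push-forward of forms is push-forward of residues. -/
lemma smul_ofResidues (T : PSL(2, ℂ)) {r : OnePoint ℂ →₀ ℂ} (hr : r.degree = 0) :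
    T • ofResidues r = ofResidues (r.mapDomain (T • ·)) := by
  induction T using QuotientGroup.induction_on with
  | H g => rw [mk_smul, pullback_ofResidues g⁻¹ hr, inv_inv]; rfl

lemma algebraMap_C (c : ℂ) : ((RatFunc.C c : RatFunc ℂ) : LaurentSeries ℂ) = HahnSeries.C c := by
  rw [← RatFunc.algebraMap_C, ← IsScalarTower.algebraMap_apply]
  simp

/-- Away from its pole, `1 / (z - e)` has a power series expansion at `0`. -/
lemma algebraMap_inv_X_sub_C {e : ℂ} (he : e ≠ 0) :
    ∃ h : PowerSeries ℂ, ((RatFunc.X - RatFunc.C e)⁻¹ : RatFunc ℂ) =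
      HahnSeries.ofPowerSeries ℤ ℂ h := by
  have hp : (PowerSeries.X - PowerSeries.C e) * (PowerSeries.X - PowerSeries.C e)⁻¹ = 1 :=
    PowerSeries.mul_inv_cancel _ (by simpa using he)
  refine ⟨(PowerSeries.X - PowerSeries.C e)⁻¹, ?_⟩
  rw [map_inv₀]
  refine inv_eq_of_mul_eq_one_right ?_
  have hX : ((RatFunc.X - RatFunc.C e : RatFunc ℂ) : LaurentSeries ℂ) =
      HahnSeries.ofPowerSeries ℤ ℂ (PowerSeries.X - PowerSeries.C e) := by
    rw [map_sub, map_sub, RatFunc.coe_X, HahnSeries.ofPowerSeries_X, HahnSeries.ofPowerSeries_C,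
      algebraMap_C]
  rw [hX, ← map_mul, hp, map_one]

/-- The Laurent expansion of `∑ r_p / (z - p)` at `a`: its principal part is `r_a / (z - a)`. -/
lemma exists_laurent_ofResidues (a : ℂ) (r : OnePoint ℂ →₀ ℂ) :
    ∃ h : PowerSeries ℂ, (RatFunc.laurent a (ofResidues r).coeff : LaurentSeries ℂ) =
      HahnSeries.single (-1) (r a) + HahnSeries.ofPowerSeries ℤ ℂ h := by
  induction r using Finsupp.induction_linear with
  | zero => exact ⟨0, by simp [ofResidues]⟩
  | add r s hr hs =>
    obtain ⟨h, hh⟩ := hr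
    obtain ⟨k, hk⟩ := hs
    refine ⟨h + k, ?_⟩
    simp only [ofResidues, map_add] at hh hk ⊢
    rw [hh, hk, Finsupp.add_apply, HahnSeries.single_add]
    abel
  | single p c =>
    cases p with
    | infty => exact ⟨0, by simp [ofResidues, cauchyKernel_infty]⟩
    | coe b =>
      simp only [ofResidues, Finsupp.linearCombination_single, cauchyKernel_coe,
        RatFunc.smul_eq_C_mul, map_mul, map_inv₀, map_sub, RatFunc.laurent_X, RatFunc.laurent_C]
      by_cases hab : b = a
      · subst hab
        refine ⟨0, ?_⟩
        rw [algebraMap_C, ← map_sub, add_sub_cancel_right, RatFunc.coe_X]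
        simp
      · obtain ⟨h, hh⟩ := algebraMap_inv_X_sub_C (sub_ne_zero.mpr hab)
        refine ⟨PowerSeries.C c * h, ?_⟩
        have hne : (b : OnePoint ℂ) ≠ (a : OnePoint ℂ) := fun h => hab (OnePoint.coe_injective h)
        have hX : (RatFunc.X + RatFunc.C a - RatFunc.C b : RatFunc ℂ) =
            RatFunc.X - RatFunc.C (b - a) := by
          rw [map_sub]
          ring
        rw [← map_sub, ← map_inv₀, hX, hh, algebraMap_C, Finsupp.single_eq_of_ne hne.symm,
          HahnSeries.single_eq_zero, zero_add, map_mul, HahnSeries.ofPowerSeries_C]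

/-- Order and residue of a rational function with at most a simple pole at `0`. -/
lemma orderAtZero_residueAtZero {f : RatFunc ℂ} {c : ℂ} {h : PowerSeries ℂ}
    (hf : (f : LaurentSeries ℂ) = HahnSeries.single (-1) c + HahnSeries.ofPowerSeries ℤ ℂ h) :
    (orderAtZero f < 0 ↔ c ≠ 0) ∧ (c ≠ 0 → orderAtZero f = -1) ∧ residueAtZero f = c := by
  have hcoeff : ∀ n : ℤ, n < -1 → (f : LaurentSeries ℂ).coeff n = 0 := by
    intro n hn
    rw [hf, HahnSeries.coeff_add, HahnSeries.coeff_single_of_ne (by omega),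
      PowerSeries.coeff_coe, if_pos (by omega), add_zero]
  have hres : (f : LaurentSeries ℂ).coeff (-1) = c := by
    rw [hf, HahnSeries.coeff_add, HahnSeries.coeff_single_same, PowerSeries.coeff_coe,
      if_pos (by omega), add_zero]
  have hone : c ≠ 0 → orderAtZero f = -1 := by
    intro hc
    have h1 : (f : LaurentSeries ℂ).coeff (-1) ≠ 0 := by rwa [hres]
    have h0 : (f : LaurentSeries ℂ) ≠ 0 := fun h => h1 (by rw [h]; rfl)
    refine le_antisymm (HahnSeries.order_le_of_coeff_ne_zero h1) ?_
    by_contra hlt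
    exact HahnSeries.coeff_order_eq_zero.not.mpr h0 (hcoeff _ (not_le.mp hlt))
  refine ⟨⟨fun hneg hc => ?_, fun hc => by rw [hone hc]; norm_num⟩, hone, hres⟩
  by_cases h0 : (f : LaurentSeries ℂ) = 0
  · simp [orderAtZero, h0] at hneg
  · refine HahnSeries.coeff_order_eq_zero.not.mpr h0 ?_
    change (f : LaurentSeries ℂ).coeff (orderAtZero f) = 0
    rcases lt_or_eq_of_le (show orderAtZero f ≤ -1 by omega) with hlt | heq
    · exact hcoeff _ hlt
    · rw [heq, hres, hc]

/-- The expansion at any point of the sphere; the case of `∞` is reduced to that of `0` by pulling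
back under `w ↦ -1 / w`. -/
lemma exists_localCoeff_ofResidues {r : OnePoint ℂ →₀ ℂ} (hr : r.degree = 0) (p : OnePoint ℂ) :
    ∃ h : PowerSeries ℂ, (localCoeff (ofResidues r) p : LaurentSeries ℂ) =
      HahnSeries.single (-1) (r p) + HahnSeries.ofPowerSeries ℤ ℂ h := by
  cases p with
  | coe a => exact exists_laurent_ofResidues a r
  | infty =>
    obtain ⟨h, hh⟩ := exists_laurent_ofResidues 0 (r.mapDomain (inversion⁻¹ • ·))
    refine ⟨h, ?_⟩
    rw [← pullback_ofResidues inversion hr, RatFunc.laurent_at_zero] at hh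
    have h0 : inversion⁻¹ • (∞ : OnePoint ℂ) = ((0 : ℂ) : OnePoint ℂ) := by
      obtain ⟨h00, -, h10, -⟩ := inv_entries inversion
      rw [sl_smul_infty, h00, h10]
      simp [inversion]
    rw [← h0, Finsupp.mapDomain_apply (MulAction.injective inversion⁻¹)] at hh
    exact hh

lemma residue_ofResidues {r : OnePoint ℂ →₀ ℂ} (hr : r.degree = 0) (p : OnePoint ℂ) :
    residue (ofResidues r) p = r p :=
  (orderAtZero_residueAtZero (exists_localCoeff_ofResidues hr p).choose_spec).2.2

lemma poles_ofResidues {r : OnePoint ℂ →₀ ℂ} (hr : r.degree = 0) :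
    poles (ofResidues r) = r.support := by
  ext p
  rw [Finset.mem_coe, Finsupp.mem_support_iff]
  exact (orderAtZero_residueAtZero (exists_localCoeff_ofResidues hr p).choose_spec).1

lemma orderAt_ofResidues {r : OnePoint ℂ →₀ ℂ} (hr : r.degree = 0) {p : OnePoint ℂ}
    (hp : r p ≠ 0) : orderAt (ofResidues r) p = -1 :=
  (orderAtZero_residueAtZero (exists_localCoeff_ofResidues hr p).choose_spec).2.1 hp

lemma mem_isotropyGroup_ofResidues {r : OnePoint ℂ →₀ ℂ} (hr : r.degree = 0) (T : PSL(2, ℂ)) :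
    T ∈ (ofResidues r).isotropyGroup ↔ ∀ p, r (T • p) = r p := by
  have happly : ∀ p, r.mapDomain (T • ·) (T • p) = r p :=
    Finsupp.mapDomain_apply (MulAction.injective T) r
  rw [isotropyGroup, MulAction.mem_stabilizer_iff, smul_ofResidues T hr]
  constructor
  · intro h p
    rw [← residue_ofResidues hr (T • p), ← h,
      residue_ofResidues (by rw [Finsupp.degree_mapDomain, hr]), happly]
  · intro h
    congr 1
    ext p
    rw [← smul_inv_smul T p, happly, h]

end RationalOneForm

end

/-! ### The form with isotropy group `G` -/

/-- Every finite subgroup `G` of `PSL(2, ℂ)` is the isotropy group of some isochronous rational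
1-form with exactly `s` poles, all simple, for some `s ≥ 2`. -/
theorem proposition3p3 (G : Subgroup PSL(2, ℂ)) (hG : Finite G) :
    ∃ s : ℕ, 2 ≤ s ∧ ∃ ω ∈ RationalOneForm.simplePoleForms s,
      ω.IsIsochronous ∧ ω.isotropyGroup = G := by
  classical
  obtain ⟨A, B, hA, hB, hAB, hstab⟩ :=
    exists_finset_pair_stabilizer (X := OnePoint ℂ)
      (fun T hT => MobiusAction.psl_encard_fixed_le_two hT) G hG
  -- The residues: the weights make their sum vanish.
  let r : OnePoint ℂ →₀ ℂ := ∑ p ∈ A, Finsupp.single p (B.card * Complex.I) -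
    ∑ p ∈ B, Finsupp.single p (A.card * Complex.I)
  have hr : ∀ p, r p = (if p ∈ A then B.card * Complex.I else 0) -
      if p ∈ B then A.card * Complex.I else 0 := by
    intro p
    simp [r, Finsupp.single_apply]
  have hdeg : r.degree = 0 := by
    simp only [r, map_sub, map_sum, Finsupp.degree_single, Finset.sum_const, nsmul_eq_mul]
    ring
  have him : ∀ p, (r p).im = (if p ∈ A then (B.card : ℝ) else 0) -
      if p ∈ B then (A.card : ℝ) else 0 := by
    intro p
    rw [hr]
    split_ifs <;> simp
  have hApos : (0 : ℝ) < A.card := by exact_mod_cast hA.card_pos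
  have hBpos : (0 : ℝ) < B.card := by exact_mod_cast hB.card_pos
  have hdisj : ∀ p, p ∈ A → p ∉ B := fun p hp => Finset.disjoint_left.mp hAB hp
  have hmemA : ∀ p, p ∈ A ↔ 0 < (r p).im := by
    intro p
    rw [him]
    by_cases hpA : p ∈ A
    · simp [hpA, hdisj p hpA, hBpos]
    · by_cases hpB : p ∈ B <;> simp [hpA, hpB, hApos.le]
  have hmemB : ∀ p, p ∈ B ↔ (r p).im < 0 := by
    intro p
    rw [him]
    by_cases hpA : p ∈ A
    · simp [hpA, hdisj p hpA, hBpos.le]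
    · by_cases hpB : p ∈ B <;> simp [hpA, hpB, hApos]
  have hsupp : r.support = A ∪ B := by
    ext p
    rw [Finsupp.mem_support_iff, Finset.mem_union, hr]
    by_cases hpA : p ∈ A
    · simp [hpA, hdisj p hpA, hB.ne_empty]
    · by_cases hpB : p ∈ B <;> simp [hpA, hpB, hA.ne_empty]
  refine ⟨(A ∪ B).card, ?_, RationalOneForm.ofResidues r, ⟨?_, ?_⟩, ?_, ?_⟩
  · rw [Finset.card_union_of_disjoint hAB]
    have := hA.card_pos
    have := hB.card_pos
    omega
  · rw [RationalOneForm.poles_ofResidues hdeg, Set.encard_coe_eq_coe_finsetCard, hsupp]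
  · intro p hp
    rw [RationalOneForm.poles_ofResidues hdeg, Finset.mem_coe, Finsupp.mem_support_iff] at hp
    exact RationalOneForm.orderAt_ofResidues hdeg hp
  · intro p _
    rw [RationalOneForm.residue_ofResidues hdeg, hr]
    split_ifs <;> simp
  · ext T
    rw [RationalOneForm.mem_isotropyGroup_ofResidues hdeg, hstab]
    constructor
    · intro h
      exact ⟨fun x => by rw [hmemA, hmemA, h], fun x => by rw [hmemB, hmemB, h]⟩
    · rintro ⟨h1, h2⟩ p
      simp only [hr, h1, h2]
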